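/- Let $d$ be a natural number and let $\mathcal{S}_d$ be the set of density matrices of dimension $d$, i.e. of positive semidefinite complex $d\times d$ matrices of unit trace. For $\rho,\sigma\in\mathcal{S}_d$ let $$F(\rho,\sigma)=\left(\operatorname{tr}\sqrt{\sqrt{\rho}\,\sigma\sqrt{\rho}}\right)^2$$ be the Uhlmann–Jozsa fidelity, where $\sqrt{A}$ denotes the positive semidefinite square root of a positive semidefinite matrix $A$. Then $0\le F(\rho,\sigma)\le 1$ for all $\rho,\sigma\in\mathcal{S}_d$, so that the Bures distance and the sine distance $$B[F(\rho,\sigma)]=\sqrt{2-2\sqrt{F(\rho,\sigma)}},\qquad C[F(\rho,\sigma)]=\sqrt{1-F(\rho,\sigma)}$$ are well defined, and both are metrics on $\mathcal{S}_d$: each of $D=B[F]$ and $D=C[F]$ satisfies, for all $\rho,\sigma,\tau\in\mathcal{S}_d$, $D(\rho,\sigma)\ge 0$; $D(\rho,\sigma)=0$ if and only if $\rho=\sigma$; $D(\rho,\sigma)=D(\sigma,\rho)$; and $D(\rho,\tau)\le D(\rho,\sigma)+D(\sigma,\tau)$. -/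

import Mathlib

open scoped ComplexOrder MatrixOrder

/-- A density matrix on `ℂⁿ` (`n` a finite index type): a positive semidefinite complex matrix
of unit trace. -/
structure DensityMatrix (n : Type*) [Fintype n] where
  /-- The underlying matrix. -/
  toMatrix : Matrix n n ℂ
  posSemidef : toMatrix.PosSemidef
  trace_eq_one : toMatrix.trace = 1

/-- The Uhlmann-Jozsa fidelity `F(ρ, σ) = (tr √(√ρ σ √ρ))²`. Here `CFC.sqrt` is the positive
semidefinite square root of a positive semidefinite matrix; the trace is that of a positive
semidefinite matrix, hence a nonnegative real, and `.re` only changes its type. -/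
noncomputable def fidelity {n : Type*} [Fintype n] [DecidableEq n]
    (ρ σ : DensityMatrix n) : ℝ :=
  (CFC.sqrt (CFC.sqrt ρ.toMatrix * σ.toMatrix * CFC.sqrt ρ.toMatrix)).trace.re ^ 2

/-- The Bures distance `B[F(ρ, σ)] = √(2 - 2 √F(ρ, σ))`. -/
noncomputable def buresDistance {n : Type*} [Fintype n] [DecidableEq n]
    (ρ σ : DensityMatrix n) : ℝ :=
  Real.sqrt (2 - 2 * Real.sqrt (fidelity ρ σ))

/-- The sine distance `C[F(ρ, σ)] = √(1 - F(ρ, σ))`. -/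
noncomputable def sineDistance {n : Type*} [Fintype n] [DecidableEq n]
    (ρ σ : DensityMatrix n) : ℝ :=
  Real.sqrt (1 - fidelity ρ σ)

/-- The function `D : S × S → ℝ` is a metric on `S`. -/
structure IsMetric {S : Type*} (D : S → S → ℝ) : Prop where
  nonneg : ∀ a b, 0 ≤ D a b
  eq_zero_iff : ∀ a b, D a b = 0 ↔ a = b
  symm : ∀ a b, D a b = D b a
  triangle : ∀ a b c, D a c ≤ D a b + D b c

open scoped Matrix InnerProductSpace

section InnerProductSpace

/-! Uhlmann's theorem: the root fidelity is the largest real inner product of unit vectors `√ρ U`,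
`√σ V` with `U`, `V` unitary, and `V = 1` already attains it (polar decomposition of `√σ √ρ`). So
optimal purifications of ρ and τ can share one of σ (`exists_purifications`). Bures is then the norm
distance, sine the sine of the angle, and both triangle inequalities become geometry of three unit
vectors. -/

theorem LinearMap.exists_linearIsometry_apply_eq {E : Type*} [NormedAddCommGroup E]
    [InnerProductSpace ℂ E] [FiniteDimensional ℂ E] (A P : E →ₗ[ℂ] E)
    (h : ∀ x, ‖A x‖ = ‖P x‖) : ∃ U : E →ₗᵢ[ℂ] E, ∀ x, U (P x) = A x := by
  obtain ⟨g, hg⟩ := P.rangeRestrict.exists_rightInverse_of_surjective P.range_rangeRestrict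
  have hPg (y : P.range) : P (g y) = y := congrArg Subtype.val (LinearMap.congr_fun hg y)
  let L : P.range →ₗᵢ[ℂ] E := ⟨A ∘ₗ g, fun y => by
    rw [LinearMap.comp_apply, h, hPg, Submodule.coe_norm]⟩
  refine ⟨L.extend, fun x => ?_⟩
  have hL := L.extend_apply ⟨P x, P.mem_range_self x⟩
  -- `g (P x)` and `x` agree under `P`, so equality of norms makes `A` kill their difference.
  refine hL.trans (sub_eq_zero.mp ?_)
  change A (g _) - A x = 0
  rw [← map_sub, ← norm_eq_zero, h, map_sub, hPg, sub_self, norm_zero]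

variable {E : Type*} [NormedAddCommGroup E] [InnerProductSpace ℝ E]

/-- Two unit vectors `x`, `z` make an angle at most the sum of the angles they make
with a third unit vector `y`. -/
theorem real_inner_mul_sub_sqrt_mul_sqrt_le {x y z : E} (hx : ‖x‖ = 1) (hy : ‖y‖ = 1)
    (hz : ‖z‖ = 1) :
    ⟪x, y⟫_ℝ * ⟪y, z⟫_ℝ - √(1 - ⟪x, y⟫_ℝ ^ 2) * √(1 - ⟪y, z⟫_ℝ ^ 2) ≤ ⟪x, z⟫_ℝ := by
  have hyy : ⟪y, y⟫_ℝ = 1 := by rw [real_inner_self_eq_norm_sq, hy, one_pow]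
  have key (w : E) (hw : ‖w‖ = 1) : ‖w - ⟪w, y⟫_ℝ • y‖ = √(1 - ⟪w, y⟫_ℝ ^ 2) := by
    rw [eq_comm, ← Real.sqrt_sq (norm_nonneg (w - ⟪w, y⟫_ℝ • y)), norm_sub_sq_real, norm_smul, hw,
      hy, real_inner_smul_right, mul_one, Real.norm_eq_abs, sq_abs]
    ring_nf
  -- Cauchy–Schwarz for the components of `x` and `z` orthogonal to `y`.
  have h := neg_le_of_abs_le (abs_real_inner_le_norm (x - ⟪x, y⟫_ℝ • y) (z - ⟪z, y⟫_ℝ • y))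
  rw [key x hx, key z hz, inner_sub_left, inner_sub_right, inner_sub_right,
    real_inner_smul_left, real_inner_smul_left, real_inner_smul_right, real_inner_smul_right,
    hyy, real_inner_comm y z] at h
  linarith

end InnerProductSpace

/-- With `a`, `b` as cosines, `h` reads `cos (α + β) ≤ c`. -/
theorem sqrt_one_sub_sq_le_add {a b c : ℝ} (ha : a ^ 2 ≤ 1) (hb : b ^ 2 ≤ 1) (hab0 : 0 ≤ a * b)
    (h : a * b - √(1 - a ^ 2) * √(1 - b ^ 2) ≤ c) :
    √(1 - c ^ 2) ≤ √(1 - a ^ 2) + √(1 - b ^ 2) := by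
  have hs := Real.sq_sqrt (sub_nonneg.mpr ha)
  have ht := Real.sq_sqrt (sub_nonneg.mpr hb)
  have hs0 := Real.sqrt_nonneg (1 - a ^ 2)
  have ht0 := Real.sqrt_nonneg (1 - b ^ 2)
  generalize √(1 - a ^ 2) = s at *
  generalize √(1 - b ^ 2) = t at *
  rw [Real.sqrt_le_left (add_nonneg hs0 ht0)]
  have hst := mul_nonneg hs0 ht0
  have hprod : (a * b) ^ 2 = (1 - s ^ 2) * (1 - t ^ 2) := by rw [hs, ht]; ring
  rcases le_total (a * b) (s * t) with hab | hab
  -- Here `s ^ 2 + t ^ 2 ≥ 1`, so the bound holds for every `c`.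
  · have := pow_le_pow_left₀ hab0 hab 2
    nlinarith [sq_nonneg c]
  · have hc : (a * b - s * t) ^ 2 ≤ c ^ 2 := pow_le_pow_left₀ (sub_nonneg.mpr hab) h 2
    have hab1 : a * b ≤ 1 := by nlinarith [sq_nonneg (a - b)]
    nlinarith [mul_nonneg hst (sub_nonneg.mpr hab1), mul_nonneg hst hst]

/-! ### Polar decomposition and the trace norm -/

namespace Matrix

theorem real_inner_toLp_vec {n : Type*} [Fintype n] (A B : Matrix n n ℂ) :
    ⟪WithLp.toLp 2 A.vec, WithLp.toLp 2 B.vec⟫_ℝ = (Aᴴ * B).trace.re := by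
  rw [← star_vec_dotProduct_vec, dotProduct, Complex.re_sum, PiLp.inner_apply]
  exact Finset.sum_congr rfl fun _ _ => congrArg Complex.re (mul_comm _ _)

variable {n : Type*} [Fintype n] [DecidableEq n]

theorem exists_mem_unitaryGroup_eq_mul {A P : Matrix n n ℂ} (h : Aᴴ * A = Pᴴ * P) :
    ∃ U ∈ unitaryGroup n ℂ, A = U * P := by
  have hT : star (toEuclideanCLM (𝕜 := ℂ) A) * toEuclideanCLM (𝕜 := ℂ) A =
      star (toEuclideanCLM (𝕜 := ℂ) P) * toEuclideanCLM (𝕜 := ℂ) P := by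
    rw [← map_star, ← map_star, ← map_mul, ← map_mul, star_eq_conjTranspose,
      star_eq_conjTranspose, h]
  have hnorm (x) : ‖toEuclideanCLM (𝕜 := ℂ) A x‖ = ‖toEuclideanCLM (𝕜 := ℂ) P x‖ := by
    rw [← sq_eq_sq₀ (norm_nonneg _) (norm_nonneg _),
      ContinuousLinearMap.apply_norm_sq_eq_inner_adjoint_left,
      ContinuousLinearMap.apply_norm_sq_eq_inner_adjoint_left]
    exact congrArg (fun S : EuclideanSpace ℂ n →L[ℂ] EuclideanSpace ℂ n =>
      RCLike.re ⟪S x, x⟫_ℂ) hT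
  obtain ⟨L, hL⟩ := LinearMap.exists_linearIsometry_apply_eq
    (toEuclideanCLM (𝕜 := ℂ) A).toLinearMap (toEuclideanCLM (𝕜 := ℂ) P).toLinearMap hnorm
  obtain ⟨U, hU⟩ :=
    EquivLike.surjective (toEuclideanCLM (n := n) (𝕜 := ℂ)) L.toContinuousLinearMap
  refine ⟨U, mem_unitaryGroup_iff'.mpr ?_, ?_⟩
  · apply EquivLike.injective (toEuclideanCLM (n := n) (𝕜 := ℂ))
    rw [map_mul, map_star, hU, map_one]
    exact (ContinuousLinearMap.norm_map_iff_adjoint_comp_self _).mp L.norm_map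
  · apply EquivLike.injective (toEuclideanCLM (n := n) (𝕜 := ℂ))
    rw [map_mul, hU]
    exact ContinuousLinearMap.ext fun x => (hL x).symm

/-- Write `P = Q Qᴴ` and expand `0 ≤ tr ((Q - U Q)ᴴ (Q - U Q))`. -/
theorem PosSemidef.re_trace_mul_le {P : Matrix n n ℂ} (hP : P.PosSemidef) {U : Matrix n n ℂ}
    (hU : U ∈ unitaryGroup n ℂ) : (U * P).trace.re ≤ P.trace.re := by
  obtain ⟨Q, rfl⟩ := CStarAlgebra.nonneg_iff_eq_mul_star_self.mp hP.nonneg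
  have hUU : Uᴴ * U = 1 := mem_unitaryGroup_iff'.mp hU
  have h := (Complex.le_def.mp
    (posSemidef_conjTranspose_mul_self (Q - U * Q)).trace_nonneg).1
  have h1 : ((Q - U * Q)ᴴ * (Q - U * Q)).trace
      = 2 * (Qᴴ * Q).trace - ((Qᴴ * U * Q).trace + star (Qᴴ * U * Q).trace) := by
    rw [← trace_conjTranspose]
    simp only [conjTranspose_sub, conjTranspose_mul, conjTranspose_conjTranspose, sub_mul, mul_sub,
      trace_sub, Matrix.mul_assoc]
    rw [← Matrix.mul_assoc Uᴴ U Q, hUU, Matrix.one_mul]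
    ring
  have h2 : (U * (Q * Qᴴ)).trace = (Qᴴ * U * Q).trace := by
    rw [← Matrix.mul_assoc, trace_mul_comm, Matrix.mul_assoc]
  rw [h1, Complex.sub_re, Complex.add_re, Complex.star_def, Complex.conj_re, two_mul,
    Complex.add_re, Complex.zero_re] at h
  rw [star_eq_conjTranspose, h2, trace_mul_comm Q]
  linarith

theorem re_trace_unitary_mul_le (A : Matrix n n ℂ) {U : Matrix n n ℂ}
    (hU : U ∈ unitaryGroup n ℂ) : (U * A).trace.re ≤ (CFC.sqrt (Aᴴ * A)).trace.re := by
  have hP := nonneg_iff_posSemidef.mp (CFC.sqrt_nonneg (Aᴴ * A))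
  have hPP := CFC.sqrt_mul_sqrt_self (Aᴴ * A) (posSemidef_conjTranspose_mul_self A).nonneg
  obtain ⟨W, hW, hA⟩ := exists_mem_unitaryGroup_eq_mul (A := A) (P := CFC.sqrt (Aᴴ * A))
    (by rw [hP.isHermitian.eq, hPP])
  calc (U * A).trace.re = (U * W * CFC.sqrt (Aᴴ * A)).trace.re := by
        rw [Matrix.mul_assoc, ← hA]
    _ ≤ _ := hP.re_trace_mul_le (mul_mem hU hW)

theorem exists_re_trace_unitary_mul_eq (A : Matrix n n ℂ) :
    ∃ U ∈ unitaryGroup n ℂ, (U * A).trace.re = (CFC.sqrt (Aᴴ * A)).trace.re := by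
  have hP := nonneg_iff_posSemidef.mp (CFC.sqrt_nonneg (Aᴴ * A))
  have hPP := CFC.sqrt_mul_sqrt_self (Aᴴ * A) (posSemidef_conjTranspose_mul_self A).nonneg
  obtain ⟨W, hW, hA⟩ := exists_mem_unitaryGroup_eq_mul (A := A) (P := CFC.sqrt (Aᴴ * A))
    (by rw [hP.isHermitian.eq, hPP])
  refine ⟨star W, Unitary.star_mem hW, ?_⟩
  nth_rw 1 [hA]
  rw [← Matrix.mul_assoc, mem_unitaryGroup_iff'.mp hW, Matrix.one_mul]

end Matrix

/-! ### Uhlmann's theorem and the metric axioms -/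

namespace DensityMatrix

open Matrix

@[ext]
theorem ext {n : Type*} [Fintype n] {ρ σ : DensityMatrix n} (h : ρ.toMatrix = σ.toMatrix) : ρ = σ := by
  cases ρ; cases σ; congr

variable {n : Type*} [Fintype n] [DecidableEq n]

/-- The purification `√ρ U` of `ρ`, as a vector. -/
noncomputable def purification (ρ : DensityMatrix n) (U : Matrix n n ℂ) :
    EuclideanSpace ℂ (n × n) :=
  WithLp.toLp 2 (CFC.sqrt ρ.toMatrix * U).vec

/-- The square root of the fidelity. -/
noncomputable def rootFidelity (ρ σ : DensityMatrix n) : ℝ :=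
  (CFC.sqrt (CFC.sqrt ρ.toMatrix * σ.toMatrix * CFC.sqrt ρ.toMatrix)).trace.re

theorem sqrt_mul_sqrt (ρ : DensityMatrix n) :
    CFC.sqrt ρ.toMatrix * CFC.sqrt ρ.toMatrix = ρ.toMatrix :=
  CFC.sqrt_mul_sqrt_self _ ρ.posSemidef.nonneg

theorem conjTranspose_sqrt (ρ : DensityMatrix n) :
    (CFC.sqrt ρ.toMatrix)ᴴ = CFC.sqrt ρ.toMatrix :=
  (nonneg_iff_posSemidef.mp (CFC.sqrt_nonneg ρ.toMatrix)).isHermitian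

theorem rootFidelity_eq (ρ σ : DensityMatrix n) : rootFidelity ρ σ =
    (CFC.sqrt ((CFC.sqrt σ.toMatrix * CFC.sqrt ρ.toMatrix)ᴴ *
      (CFC.sqrt σ.toMatrix * CFC.sqrt ρ.toMatrix))).trace.re := by
  rw [rootFidelity, conjTranspose_mul, conjTranspose_sqrt, conjTranspose_sqrt,
    Matrix.mul_assoc (CFC.sqrt ρ.toMatrix) (CFC.sqrt σ.toMatrix),
    ← Matrix.mul_assoc (CFC.sqrt σ.toMatrix) (CFC.sqrt σ.toMatrix), sqrt_mul_sqrt,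
    Matrix.mul_assoc]

theorem real_inner_purification (ρ σ : DensityMatrix n) (U V : Matrix n n ℂ) :
    ⟪σ.purification V, ρ.purification U⟫_ℝ =
      (U * Vᴴ * (CFC.sqrt σ.toMatrix * CFC.sqrt ρ.toMatrix)).trace.re := by
  rw [purification, purification, real_inner_toLp_vec, conjTranspose_mul, conjTranspose_sqrt,
    ← Matrix.mul_assoc, trace_mul_comm]
  simp only [Matrix.mul_assoc]

theorem real_inner_purification_le (ρ σ : DensityMatrix n) {U V : Matrix n n ℂ}
    (hU : U ∈ unitaryGroup n ℂ) (hV : V ∈ unitaryGroup n ℂ) :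
    ⟪σ.purification V, ρ.purification U⟫_ℝ ≤ rootFidelity ρ σ := by
  rw [real_inner_purification, rootFidelity_eq]
  exact re_trace_unitary_mul_le _ (mul_mem hU (Unitary.star_mem hV))

theorem exists_real_inner_purification_eq (ρ σ : DensityMatrix n) :
    ∃ U ∈ unitaryGroup n ℂ, ⟪σ.purification 1, ρ.purification U⟫_ℝ = rootFidelity ρ σ := by
  obtain ⟨U, hU, h⟩ := exists_re_trace_unitary_mul_eq (CFC.sqrt σ.toMatrix * CFC.sqrt ρ.toMatrix)
  refine ⟨U, hU, ?_⟩
  rw [real_inner_purification, rootFidelity_eq, conjTranspose_one, Matrix.mul_one, h]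

theorem norm_purification (ρ : DensityMatrix n) {U : Matrix n n ℂ} (hU : U ∈ unitaryGroup n ℂ) :
    ‖ρ.purification U‖ = 1 := by
  rw [← sq_eq_sq₀ (norm_nonneg _) zero_le_one, ← real_inner_self_eq_norm_sq,
    real_inner_purification, sqrt_mul_sqrt, ← star_eq_conjTranspose, mem_unitaryGroup_iff.mp hU,
    Matrix.one_mul, ρ.trace_eq_one, Complex.one_re, one_pow]

/-- The state is recovered from `X = √ρ U` as `X Xᴴ`. -/
theorem eq_of_purification_eq {ρ σ : DensityMatrix n} {U V : Matrix n n ℂ}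
    (hU : U ∈ unitaryGroup n ℂ) (hV : V ∈ unitaryGroup n ℂ)
    (h : ρ.purification U = σ.purification V) : ρ = σ := by
  have key (τ : DensityMatrix n) {W : Matrix n n ℂ} (hW : W ∈ unitaryGroup n ℂ) :
      CFC.sqrt τ.toMatrix * W * (CFC.sqrt τ.toMatrix * W)ᴴ = τ.toMatrix := by
    rw [conjTranspose_mul, conjTranspose_sqrt, Matrix.mul_assoc, ← Matrix.mul_assoc W,
      ← star_eq_conjTranspose, mem_unitaryGroup_iff.mp hW, Matrix.one_mul, sqrt_mul_sqrt]
  have h' := vec_inj.mp (WithLp.toLp_injective 2 h)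
  ext1
  rw [← key ρ hU, h', key σ hV]

theorem rootFidelity_nonneg (ρ σ : DensityMatrix n) : 0 ≤ rootFidelity ρ σ :=
  (Complex.le_def.mp (nonneg_iff_posSemidef.mp (CFC.sqrt_nonneg _)).trace_nonneg).1

theorem rootFidelity_comm (ρ σ : DensityMatrix n) : rootFidelity ρ σ = rootFidelity σ ρ := by
  have key (ρ σ : DensityMatrix n) : rootFidelity ρ σ ≤ rootFidelity σ ρ := by
    obtain ⟨U, hU, h⟩ := exists_real_inner_purification_eq ρ σ
    rw [← h, real_inner_comm]
    exact real_inner_purification_le σ ρ (one_mem _) hU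
  exact le_antisymm (key ρ σ) (key σ ρ)

theorem rootFidelity_le_one (ρ σ : DensityMatrix n) : rootFidelity ρ σ ≤ 1 := by
  obtain ⟨U, hU, h⟩ := exists_real_inner_purification_eq ρ σ
  rw [← h]
  refine (real_inner_le_norm _ _).trans ?_
  rw [norm_purification σ (one_mem _), norm_purification ρ hU, one_mul]

theorem rootFidelity_eq_one_iff (ρ σ : DensityMatrix n) : rootFidelity ρ σ = 1 ↔ ρ = σ := by
  constructor
  · intro h1
    obtain ⟨U, hU, h⟩ := exists_real_inner_purification_eq ρ σ
    -- Unit vectors with inner product 1 coincide.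
    rw [h1, inner_eq_one_iff_of_norm_eq_one (norm_purification σ (one_mem _))
      (norm_purification ρ hU)] at h
    exact (eq_of_purification_eq (one_mem _) hU h).symm
  · rintro rfl
    refine le_antisymm (rootFidelity_le_one _ _) ?_
    have h := real_inner_purification_le ρ ρ (one_mem _) (one_mem _)
    rwa [real_inner_self_eq_norm_sq, norm_purification ρ (one_mem _), one_pow] at h

/-- Any three density matrices have purifications such that the fidelities of the second with the
other two are attained simultaneously. -/
theorem exists_purifications (ρ σ τ : DensityMatrix n) : ∃ x y z : EuclideanSpace ℂ (n × n),
    ‖x‖ = 1 ∧ ‖y‖ = 1 ∧ ‖z‖ = 1 ∧ ⟪x, y⟫_ℝ = rootFidelity ρ σ ∧ ⟪y, z⟫_ℝ = rootFidelity σ τ ∧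
      ⟪x, z⟫_ℝ ≤ rootFidelity ρ τ := by
  obtain ⟨U, hU, h⟩ := exists_real_inner_purification_eq ρ σ
  obtain ⟨V, hV, h'⟩ := exists_real_inner_purification_eq τ σ
  refine ⟨ρ.purification U, σ.purification 1, τ.purification V, norm_purification ρ hU,
    norm_purification σ (one_mem _), norm_purification τ hV, ?_, ?_, ?_⟩
  · rw [real_inner_comm, h]
  · rw [h', rootFidelity_comm]
  · rw [real_inner_comm]
    exact real_inner_purification_le ρ τ hU hV

theorem fidelity_eq (ρ σ : DensityMatrix n) : fidelity ρ σ = rootFidelity ρ σ ^ 2 := rfl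

theorem fidelity_eq_one_iff (ρ σ : DensityMatrix n) : fidelity ρ σ = 1 ↔ ρ = σ := by
  rw [fidelity_eq, pow_eq_one_iff_of_nonneg (rootFidelity_nonneg ρ σ) two_ne_zero,
    rootFidelity_eq_one_iff]

theorem fidelity_comm (ρ σ : DensityMatrix n) : fidelity ρ σ = fidelity σ ρ := by
  rw [fidelity_eq, fidelity_eq, rootFidelity_comm]

theorem fidelity_nonneg (ρ σ : DensityMatrix n) : 0 ≤ fidelity ρ σ := sq_nonneg _

theorem fidelity_le_one (ρ σ : DensityMatrix n) : fidelity ρ σ ≤ 1 :=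
  pow_le_one₀ (rootFidelity_nonneg ρ σ) (rootFidelity_le_one ρ σ)

theorem buresDistance_eq (ρ σ : DensityMatrix n) :
    buresDistance ρ σ = √(2 - 2 * rootFidelity ρ σ) := by
  rw [buresDistance, fidelity_eq, Real.sqrt_sq (rootFidelity_nonneg ρ σ)]

theorem isMetric_buresDistance : IsMetric (buresDistance (n := n)) where
  nonneg _ _ := Real.sqrt_nonneg _
  eq_zero_iff ρ σ := by
    rw [buresDistance_eq, Real.sqrt_eq_zero (by linarith [rootFidelity_le_one ρ σ]),
      ← rootFidelity_eq_one_iff]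
    constructor <;> intro h <;> linarith
  symm ρ σ := by rw [buresDistance, buresDistance, fidelity_comm]
  triangle ρ σ τ := by
    obtain ⟨x, y, z, hx, hy, hz, hxy, hyz, hxz⟩ := exists_purifications ρ σ τ
    have key (v w : EuclideanSpace ℂ (n × n)) (hv : ‖v‖ = 1) (hw : ‖w‖ = 1) :
        ‖v - w‖ = √(2 - 2 * ⟪v, w⟫_ℝ) := by
      rw [← Real.sqrt_sq (norm_nonneg (v - w)), norm_sub_sq_real, hv, hw]
      ring_nf
    rw [buresDistance_eq, buresDistance_eq, buresDistance_eq, ← hxy, ← hyz, ← key x y hx hy,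
      ← key y z hy hz]
    -- `x`, `z` need not be optimal for ρ, τ: `hxz` gives the direction needed.
    refine le_trans ?_ (norm_sub_le_norm_sub_add_norm_sub x y z)
    rw [key x z hx hz]
    exact Real.sqrt_le_sqrt (by linarith)

theorem isMetric_sineDistance : IsMetric (sineDistance (n := n)) where
  nonneg _ _ := Real.sqrt_nonneg _
  eq_zero_iff ρ σ := by
    rw [sineDistance, Real.sqrt_eq_zero (sub_nonneg.mpr (fidelity_le_one ρ σ)), sub_eq_zero,
      eq_comm, fidelity_eq_one_iff]
  symm ρ σ := by rw [sineDistance, sineDistance, fidelity_comm]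
  triangle ρ σ τ := by
    obtain ⟨x, y, z, hx, hy, hz, hxy, hyz, hxz⟩ := exists_purifications ρ σ τ
    have h := (real_inner_mul_sub_sqrt_mul_sqrt_le hx hy hz).trans hxz
    rw [hxy, hyz] at h
    exact sqrt_one_sub_sq_le_add (fidelity_le_one ρ σ) (fidelity_le_one σ τ)
      (mul_nonneg (rootFidelity_nonneg ρ σ) (rootFidelity_nonneg σ τ)) h

end DensityMatrix

theorem propositionB2 {n : Type*} [Fintype n] [DecidableEq n] :
    (∀ ρ σ : DensityMatrix n, 0 ≤ fidelity ρ σ ∧ fidelity ρ σ ≤ 1) ∧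
      IsMetric (buresDistance (n := n)) ∧ IsMetric (sineDistance (n := n)) :=
  ⟨fun ρ σ => ⟨ρ.fidelity_nonneg σ, ρ.fidelity_le_one σ⟩,
    DensityMatrix.isMetric_buresDistance, DensityMatrix.isMetric_sineDistance⟩
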